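/- **Theorem.** Let $B$ and $D$ be C*-algebras, $\pi : B \to D$ a surjective $*$-homomorphism, $E \subseteq D$ a (norm-)closed subset, and $s_0 : E \to B$ a continuous section of $\pi$ over $E$, that is, a norm-continuous map (not assumed linear) with $\pi(s_0(x)) = x$ for all $x \in E$. Then there is a continuous map $s : D \to B$ with $\pi(s(x)) = x$ for all $x \in D$ and $s|_E = s_0$, which moreover has each of the following properties that $s_0$ has: 1. *contractive*: if $\|s_0(x)\| \le \|x\|$ for all $x \in E$, then $\|s(x)\| \le \|x\|$ for all $x \in D$; 2. *selfadjoint*: if $s_0(x^*) = s_0(x)^*$ whenever $x$ and $x^*$ both lie in $E$, then $s(x^*) = s(x)^*$ for all $x \in D$; 3. *positive*: if $s_0(x) \ge 0$ for all $x \in E$ with $x \ge 0$, then $s(x) \ge 0$ for all $x \in D$ with $x \ge 0$. If, in addition, $B$ and $D$ are unital (then $\pi(1) = 1$, since $\pi$ is surjective), and it is not the case that both $D = 0$ and $E = \emptyset$, then $s$ can be chosen to have, besides all of the above, also the property 4. *unital*: if $s_0(1) = 1$ or $1 \notin E$, then $s(1) = 1$. -/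

import Mathlib

/-!
Following Michael, `s` is found by successively refining approximate selections of the fibres of
`π`, cut down to the single point `s₀ x` over `x ∈ E`; these sets vary lower hemicontinuously
because `π` is open. The three properties are then forced one at a time. Since `|·|` commutes with
`π`, replacing a section by its modulus gives a positive section over the closed cone of positive
elements, which can be prescribed along with `s₀` before extending. Every C⋆-algebra has a
continuous retraction onto the closed ball of radius `r` that commutes with `π`; retracting `s x` to
the ball of radius `‖x‖` makes `s` contractive. Finally `x ↦ (s x + s(x⋆)⋆) / 2` is selfadjoint, and
it still extends `s₀` if `s` was made to extend `x ↦ s₀(x⋆)⋆` on `E⋆` as well. The unital case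
prescribes the value `1` at `1`.
-/

open Filter Set Topology

/-! ### Michael's selection theorem -/

section Selection

variable {X Y : Type*} [TopologicalSpace X]

theorem mem_closure_of_tendsto_of_mem_thickening [PseudoMetricSpace Y] {ι : Type*} {l : Filter ι}
    [l.NeBot] {u : ι → Y} {δ : ι → ℝ} {a : Y} {S : Set Y} (hu : Tendsto u l (𝓝 a))
    (hδ : Tendsto δ l (𝓝 0)) (hS : ∀ i, u i ∈ Metric.thickening (δ i) S) : a ∈ closure S := by
  choose z hz hzu using fun i => Metric.mem_thickening_iff.1 (hS i)
  have hza : Tendsto z l (𝓝 a) := (tendsto_iff_of_dist <| squeeze_zero (fun _ => dist_nonneg)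
    (fun i => (hzu i).le) hδ).1 hu
  exact mem_closure_of_tendsto hza (.of_forall hz)

theorem exists_continuous_forall_tendsto_of_dist_le_geometric [MetricSpace Y] [CompleteSpace Y]
    {u : ℕ → C(X, Y)} {C r : ℝ} (hr₀ : 0 ≤ r) (hr₁ : r < 1)
    (hu : ∀ n x, dist (u n x) (u (n + 1) x) ≤ C * r ^ n) :
    ∃ g : C(X, Y), ∀ x, Tendsto (u · x) atTop (𝓝 (g x)) := by
  choose g hg using fun x =>
    cauchySeq_tendsto_of_complete (cauchySeq_of_le_geometric r C hr₁ (hu · x))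
  have htail : Tendsto (fun n => C * r ^ n / (1 - r)) atTop (𝓝 0) := by
    simpa using ((tendsto_pow_atTop_nhds_zero_of_lt_one hr₀ hr₁).const_mul C).div_const (1 - r)
  have hunif : TendstoUniformly (fun n => u n) g atTop := by
    refine Metric.tendstoUniformly_iff.2 fun ε hε => ?_
    filter_upwards [htail.eventually (gt_mem_nhds hε)] with n hn x
    rw [dist_comm]
    exact (dist_le_of_le_geometric_of_tendsto r C hr₁ (hu · x) (hg x) n).trans_lt hn
  exact ⟨⟨g, hunif.continuous (.of_forall fun n => (u n).continuous)⟩, hg⟩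

variable [NormalSpace X] [ParacompactSpace X] [NormedAddCommGroup Y] [NormedSpace ℝ Y]
  {Φ : X → Set Y}

theorem exists_continuous_forall_mem_thickening (hΦ : LowerHemicontinuous Φ)
    (hconv : ∀ x, Convex ℝ (Φ x)) (hne : ∀ x, (Φ x).Nonempty) {ε : ℝ} (hε : 0 < ε) :
    ∃ g : C(X, Y), ∀ x, g x ∈ Metric.thickening ε (Φ x) := by
  refine exists_continuous_forall_mem_convex_of_local_const (fun x => (hconv x).thickening ε)
    fun x => ?_
  obtain ⟨c, hc⟩ := hne x
  have hmeets : ∀ᶠ x' in 𝓝 x, (Φ x' ∩ Metric.ball c ε).Nonempty :=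
    lowerHemicontinuousAt_iff.1 (hΦ x) _ Metric.isOpen_ball ⟨c, hc, Metric.mem_ball_self hε⟩
  refine ⟨c, hmeets.mono ?_⟩
  rintro x' ⟨z, hz, hzc⟩
  exact Metric.mem_thickening_iff.2 ⟨z, hz, by rwa [dist_comm]⟩

theorem exists_continuous_forall_mem_thickening_dist_le (hΦ : LowerHemicontinuous Φ)
    (hconv : ∀ x, Convex ℝ (Φ x)) {δ ε : ℝ} (hε : 0 < ε) {g : C(X, Y)}
    (hg : ∀ x, g x ∈ Metric.thickening δ (Φ x)) :
    ∃ g' : C(X, Y), (∀ x, g' x ∈ Metric.thickening ε (Φ x)) ∧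
      ∀ x, dist (g x) (g' x) ≤ δ + ε := by
  have hball : HasOpenCGraph fun x => Metric.ball (g x) δ :=
    isOpen_lt (continuous_snd.dist (g.continuous.comp continuous_fst)) continuous_const
  obtain ⟨g', hg'⟩ := exists_continuous_forall_mem_thickening (hΦ.inter_hasOpenCGraph hball)
    (fun x => (hconv x).inter (convex_ball _ _))
    (fun x => let ⟨z, hz, hzg⟩ := Metric.mem_thickening_iff.1 (hg x)
      ⟨z, hz, Metric.mem_ball'.2 hzg⟩) hε
  refine ⟨g', fun x => Metric.thickening_subset_of_subset ε inter_subset_left (hg' x),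
    fun x => ?_⟩
  obtain ⟨z, ⟨-, hz⟩, hzg'⟩ := Metric.mem_thickening_iff.1 (hg' x)
  calc dist (g x) (g' x) ≤ dist (g x) z + dist (g' x) z := dist_triangle_right _ _ _
    _ ≤ δ + ε := add_le_add (Metric.mem_ball'.1 hz).le hzg'.le

theorem exists_seq_continuous_forall_mem_thickening (hΦ : LowerHemicontinuous Φ)
    (hconv : ∀ x, Convex ℝ (Φ x)) (hne : ∀ x, (Φ x).Nonempty) {δ : ℕ → ℝ} (hδ : ∀ n, 0 < δ n) :
    ∃ u : ℕ → C(X, Y), (∀ n x, u n x ∈ Metric.thickening (δ n) (Φ x)) ∧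
      ∀ n x, dist (u n x) (u (n + 1) x) ≤ δ n + δ (n + 1) := by
  obtain ⟨g₀, hg₀⟩ := exists_continuous_forall_mem_thickening hΦ hconv hne (hδ 0)
  choose next hnext hdist using fun (n : ℕ)
    (g : {g : C(X, Y) // ∀ x, g x ∈ Metric.thickening (δ n) (Φ x)}) =>
    exists_continuous_forall_mem_thickening_dist_le hΦ hconv (hδ (n + 1)) g.2
  let u : ∀ n, {g : C(X, Y) // ∀ x, g x ∈ Metric.thickening (δ n) (Φ x)} :=
    fun n => Nat.rec ⟨g₀, hg₀⟩ (fun n g => ⟨next n g, hnext n g⟩) n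
  exact ⟨fun n => (u n).1, fun n => (u n).2, fun n => hdist n (u n)⟩

/-- **Michael's selection theorem**. -/
theorem exists_continuous_selection [CompleteSpace Y] (hΦ : LowerHemicontinuous Φ)
    (hconv : ∀ x, Convex ℝ (Φ x)) (hne : ∀ x, (Φ x).Nonempty) (hcl : ∀ x, IsClosed (Φ x)) :
    ∃ g : C(X, Y), ∀ x, g x ∈ Φ x := by
  obtain ⟨u, humem, hudist⟩ := exists_seq_continuous_forall_mem_thickening hΦ hconv hne
    (δ := fun n => (1 / 2) ^ n) fun n => by positivity
  have hgeom (n x) : dist (u n x) (u (n + 1) x) ≤ 3 / 2 * (1 / 2) ^ n :=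
    (hudist n x).trans_eq (by ring)
  obtain ⟨g, hg⟩ := exists_continuous_forall_tendsto_of_dist_le_geometric (by norm_num)
    (by norm_num) hgeom
  exact ⟨g, fun x => (hcl x).closure_subset <| mem_closure_of_tendsto_of_mem_thickening (hg x)
    (tendsto_pow_atTop_nhds_zero_of_lt_one (by norm_num) (by norm_num)) (humem · x)⟩

end Selection

/-! ### Continuous sections over closed sets -/

/-- `s` restricts to a continuous section of `π` over `E`. Partial sections are encoded as total
functions whose values off `E` are irrelevant, so that their domains can vary. -/
structure IsContinuousSectionOn {X Y : Type*} [TopologicalSpace X] [TopologicalSpace Y]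
    (π : Y → X) (s : X → Y) (E : Set X) : Prop where
  continuousOn : ContinuousOn s E
  rightInvOn : RightInvOn s π E

namespace IsContinuousSectionOn

variable {X Y : Type*} [TopologicalSpace X] [TopologicalSpace Y] {π : Y → X} {s t : X → Y}
  {E F : Set X}

theorem mono (hs : IsContinuousSectionOn π s F) (hEF : E ⊆ F) : IsContinuousSectionOn π s E :=
  ⟨hs.continuousOn.mono hEF, hs.rightInvOn.mono hEF⟩

theorem congr (hs : IsContinuousSectionOn π s E) (hts : EqOn t s E) :
    IsContinuousSectionOn π t E :=
  ⟨hs.continuousOn.congr hts, hs.rightInvOn.congr_left hts.symm⟩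

theorem union (hE : IsClosed E) (hF : IsClosed F) (hsE : IsContinuousSectionOn π s E)
    (hsF : IsContinuousSectionOn π s F) : IsContinuousSectionOn π s (E ∪ F) :=
  ⟨hsE.continuousOn.union_of_isClosed hsF.continuousOn hE hF, fun _ hx =>
    hx.elim (fun h => hsE.rightInvOn h) fun h => hsF.rightInvOn h⟩

theorem exists_glue (hE : IsClosed E) (hF : IsClosed F) (hs : IsContinuousSectionOn π s E)
    (ht : IsContinuousSectionOn π t F) (hst : EqOn s t (E ∩ F)) :
    ∃ g, IsContinuousSectionOn π g (E ∪ F) ∧ EqOn g s E ∧ EqOn g t F := by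
  classical
  have hgs : EqOn (E.piecewise s t) s E := piecewise_eqOn E s t
  have hgt : EqOn (E.piecewise s t) t F := fun x hxF => by
    by_cases hxE : x ∈ E
    · exact (hgs hxE).trans (hst ⟨hxE, hxF⟩)
    · exact piecewise_eq_of_notMem _ _ _ hxE
  exact ⟨_, (hs.congr hgs).union hE hF (ht.congr hgt), hgs, hgt⟩

end IsContinuousSectionOn

/-- The fibre of `π` over `x`, cut down to `{f x}` when `x ∈ E`: its selections are the sections of
`π` that extend the restriction of `f` to `E`. -/
def pinnedFiber {X Y : Type*} (π : Y → X) (f : X → Y) (E : Set X) (x : X) : Set Y :=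
  {y | π y = x ∧ (x ∈ E → y = f x)}

section BartleGraves

theorem pinnedFiber_nonempty {X Y : Type*} {π : Y → X} {f : X → Y} {E : Set X}
    (hπ : Function.Surjective π) (hf : RightInvOn f π E) (x : X) :
    (pinnedFiber π f E x).Nonempty := by
  by_cases hx : x ∈ E
  · exact ⟨f x, hf hx, fun _ => rfl⟩
  · obtain ⟨y, hy⟩ := hπ x
    exact ⟨y, hy, fun h => absurd h hx⟩

theorem isClosed_pinnedFiber {X Y : Type*} [TopologicalSpace X] [T1Space X] [TopologicalSpace Y]
    [T1Space Y] {π : Y → X} (hπ : Continuous π) (f : X → Y) (E : Set X) (x : X) :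
    IsClosed (pinnedFiber π f E x) :=
  (isClosed_singleton.preimage hπ).inter (isClosed_imp isOpen_const isClosed_singleton)

theorem lowerHemicontinuous_pinnedFiber {X Y : Type*} [TopologicalSpace X] [TopologicalSpace Y]
    {π : Y → X} {f : X → Y} {E : Set X} (hπ : IsOpenMap π) (hE : IsClosed E)
    (hf : IsContinuousSectionOn π f E) : LowerHemicontinuous (pinnedFiber π f E) := by
  refine fun x => lowerHemicontinuousAt_iff.2 fun U hU => ?_
  rintro ⟨y, ⟨hyx, hyf⟩, hyU⟩
  have himage : ∀ᶠ x' in 𝓝 x, x' ∈ π '' U := (hπ U hU).mem_nhds ⟨y, hyU, hyx⟩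
  have hpinned : ∀ᶠ x' in 𝓝 x, x' ∈ E → f x' ∈ U := by
    by_cases hx : x ∈ E
    · exact eventually_nhdsWithin_iff.1 <|
        (hf.continuousOn x hx).eventually (hU.mem_nhds (hyf hx ▸ hyU))
    · filter_upwards [hE.isOpen_compl.mem_nhds hx] with x' hx' h using absurd h hx'
  filter_upwards [himage, hpinned]
  rintro x' ⟨z, hzU, hz⟩ hfU
  by_cases hx' : x' ∈ E
  · exact ⟨f x', ⟨hf.rightInvOn hx', fun _ => rfl⟩, hfU hx'⟩
  · exact ⟨z, ⟨hz, fun h => absurd h hx'⟩, hzU⟩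

theorem convex_pinnedFiber {F G : Type*} [AddCommGroup F] [Module ℝ F] [AddCommGroup G]
    [Module ℝ G] (T : F →ₗ[ℝ] G) (f : G → F) (E : Set G) (x : G) :
    Convex ℝ (pinnedFiber T f E x) := by
  have hpin : Convex ℝ {y | x ∈ E → y = f x} := by
    by_cases hx : x ∈ E
    · simpa only [hx, forall_const, ofPred_eq_eq_singleton] using convex_singleton (f x)
    · simpa only [hx, false_imp_iff, ofPred_true] using convex_univ
  exact ((convex_singleton x).linear_preimage T).inter hpin

/-- The **Bartle–Graves theorem**, relative to a closed set. -/
theorem exists_continuousSection_eqOn {F G : Type*} [NormedAddCommGroup F] [NormedSpace ℝ F]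
    [CompleteSpace F] [NormedAddCommGroup G] [NormedSpace ℝ G] [CompleteSpace G]
    (T : F →L[ℝ] G) (hT : Function.Surjective T) {E : Set G} (hE : IsClosed E) {f : G → F}
    (hf : IsContinuousSectionOn T f E) :
    ∃ s, IsContinuousSectionOn T s univ ∧ EqOn s f E := by
  obtain ⟨s, hs⟩ := exists_continuous_selection
    (lowerHemicontinuous_pinnedFiber (T.isOpenMap hT) hE hf)
    (convex_pinnedFiber T.toLinearMap f E) (pinnedFiber_nonempty hT hf.rightInvOn)
    (isClosed_pinnedFiber T.continuous f E)
  exact ⟨s, ⟨s.continuous.continuousOn, fun x _ => (hs x).1⟩, fun x hx => (hs x).2 hx⟩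

end BartleGraves

/-! ### Norm retractions of a C⋆-algebra -/

section Retraction

/-- The proportion `1 - 1 / max 1 t` of `t` to be removed in order to truncate `t` at `1`. -/
noncomputable def excessRatio (t : ℝ) : ℝ := 1 - (max 1 t)⁻¹

theorem continuous_excessRatio : Continuous excessRatio :=
  continuous_const.sub ((continuous_const.max continuous_id).inv₀ fun t =>
    (zero_lt_one.trans_le (le_max_left 1 t)).ne')

theorem excessRatio_of_le_one {t : ℝ} (ht : t ≤ 1) : excessRatio t = 0 := by
  simp [excessRatio, max_eq_left ht]

theorem sub_mul_excessRatio (t : ℝ) : t - t * excessRatio t = min 1 t := by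
  rcases le_total t 1 with h | h
  · rw [excessRatio_of_le_one h, mul_zero, sub_zero, min_eq_right h]
  · rw [excessRatio, max_eq_right h, min_eq_left h, mul_sub, mul_one, sub_sub_cancel,
      mul_inv_cancel₀ (zero_lt_one.trans_le h).ne']

theorem norm_sub_mul_eq_of_star_mul_self_eq {A : Type*} [NonUnitalNormedRing A] [StarRing A]
    [CStarRing A] {a b : A} (h : star a * a = star b * b) (c : A) :
    ‖a - a * c‖ = ‖b - b * c‖ := by
  have hexpand (x : A) : star (x - x * c) * (x - x * c) =
      star x * x - star x * x * c - star c * (star x * x) + star c * (star x * x) * c := by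
    simp only [star_sub, star_mul, sub_mul, mul_sub, mul_assoc]
    abel
  rw [← mul_self_inj (norm_nonneg _) (norm_nonneg _), ← CStarRing.norm_star_mul_self,
    ← CStarRing.norm_star_mul_self, hexpand, hexpand, h]

variable {A : Type*} [NonUnitalCStarAlgebra A] [PartialOrder A] [StarOrderedRing A]

/-- The retraction of a C⋆-algebra onto its closed unit ball that truncates the modulus in the polar
decomposition at `1`. In the unitization it is `a ↦ a * (max 1 |a|)⁻¹`; the subtraction keeps the
functional calculus inside `A`. -/
noncomputable def unitBallRetraction (a : A) : A := a - a * cfcₙ excessRatio (CFC.abs a)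

theorem continuous_unitBallRetraction : Continuous (unitBallRetraction : A → A) := by
  have h : Continuous fun a : A => cfcₙ excessRatio (CFC.abs a) :=
    Continuous.cfcₙ_of_mem_nhdsSet (s := univ) excessRatio univ_mem CFC.continuous_abs
      (fun a => (CFC.abs_nonneg a).isSelfAdjoint) continuous_excessRatio.continuousOn
      (excessRatio_of_le_one zero_le_one)
  exact continuous_id.sub (continuous_id.mul h)

theorem unitBallRetraction_of_norm_le_one {a : A} (ha : ‖a‖ ≤ 1) : unitBallRetraction a = a := by
  have hspec (t : ℝ) (ht : t ∈ quasispectrum ℝ (CFC.abs a)) : t ≤ 1 := calc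
    t ≤ ‖t‖ := le_abs_self t
    _ ≤ ‖CFC.abs a‖ := NonUnitalIsometricContinuousFunctionalCalculus.norm_quasispectrum_le _ ht
      (CFC.abs_nonneg a).isSelfAdjoint
    _ ≤ 1 := CFC.norm_abs.trans_le ha
  have hzero : cfcₙ excessRatio (CFC.abs a) = 0 :=
    (cfcₙ_congr fun t ht => excessRatio_of_le_one (hspec t ht)).trans (cfcₙ_const_zero ℝ _)
  rw [unitBallRetraction, hzero, mul_zero, sub_zero]

theorem unitBallRetraction_of_nonneg {a : A} (ha : 0 ≤ a) :
    unitBallRetraction a = cfcₙ (fun t : ℝ => min 1 t) a := by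
  have hcont := continuous_excessRatio
  have hsa := ha.isSelfAdjoint
  calc unitBallRetraction a
    _ = cfcₙ (fun t : ℝ => t - t * excessRatio t) a := by
      rw [unitBallRetraction, CFC.abs_of_nonneg a ha, cfcₙ_sub (fun t : ℝ => t)
        (fun t => t * excessRatio t) a (by fun_prop) rfl (by fun_prop) (zero_mul _),
        cfcₙ_mul (fun t : ℝ => t) excessRatio a (by fun_prop) rfl (by fun_prop)
        (excessRatio_of_le_one zero_le_one), cfcₙ_id' ℝ a]
    _ = cfcₙ (fun t : ℝ => min 1 t) a := cfcₙ_congr fun t _ => sub_mul_excessRatio t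

theorem unitBallRetraction_nonneg {a : A} (ha : 0 ≤ a) : 0 ≤ unitBallRetraction a := by
  rw [unitBallRetraction_of_nonneg ha]
  exact cfcₙ_nonneg fun t ht => le_min zero_le_one (quasispectrum_nonneg_of_nonneg a ha t ht)

theorem norm_unitBallRetraction_abs (a : A) :
    ‖unitBallRetraction (CFC.abs a)‖ = ‖unitBallRetraction a‖ := by
  have hmod : star (CFC.abs a) * CFC.abs a = star a * a := by
    rw [(CFC.abs_nonneg a).isSelfAdjoint.star_eq, CFC.abs_mul_abs]
  rw [unitBallRetraction, unitBallRetraction, CFC.cfcAbs_cfcAbs]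
  exact norm_sub_mul_eq_of_star_mul_self_eq hmod _

theorem norm_unitBallRetraction_le_one (a : A) : ‖unitBallRetraction a‖ ≤ 1 := by
  rw [← norm_unitBallRetraction_abs, unitBallRetraction_of_nonneg (CFC.abs_nonneg a)]
  refine norm_cfcₙ_le fun t ht => ?_
  have ht₀ : 0 ≤ t := quasispectrum_nonneg_of_nonneg _ (CFC.abs_nonneg a) t ht
  rw [Real.norm_of_nonneg (le_min zero_le_one ht₀)]
  exact min_le_left 1 t

/-- The rescaling of `unitBallRetraction` to the closed ball of radius `r`, for `0 ≤ r`. At `r = 0`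
the junk value `0⁻¹ = 0` gives the constant map `0`, as it should. -/
noncomputable def ballRetraction (r : ℝ) (a : A) : A := r • unitBallRetraction (r⁻¹ • a)

theorem norm_ballRetraction_le {r : ℝ} (hr : 0 ≤ r) (a : A) : ‖ballRetraction r a‖ ≤ r := by
  rw [ballRetraction, norm_smul, Real.norm_of_nonneg hr]
  exact mul_le_of_le_one_right hr (norm_unitBallRetraction_le_one _)

theorem ballRetraction_of_norm_le {r : ℝ} {a : A} (ha : ‖a‖ ≤ r) : ballRetraction r a = a := by
  have hr : 0 ≤ r := (norm_nonneg a).trans ha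
  rcases hr.eq_or_lt' with rfl | hr
  · rw [ballRetraction, zero_smul, norm_le_zero_iff.1 ha]
  · have hle : ‖r⁻¹ • a‖ ≤ 1 := by
      rw [norm_smul, Real.norm_of_nonneg (by positivity)]
      exact inv_mul_le_one_of_le₀ ha hr.le
    rw [ballRetraction, unitBallRetraction_of_norm_le_one hle, smul_inv_smul₀ hr.ne']

theorem ballRetraction_nonneg {r : ℝ} (hr : 0 ≤ r) {a : A} (ha : 0 ≤ a) :
    0 ≤ ballRetraction r a :=
  smul_nonneg hr (unitBallRetraction_nonneg (smul_nonneg (inv_nonneg.2 hr) ha))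

theorem continuous_ballRetraction_comp {X : Type*} [TopologicalSpace X] {r : X → ℝ} {f : X → A}
    (hr : Continuous r) (hr₀ : ∀ x, 0 ≤ r x) (hf : Continuous f) :
    Continuous fun x => ballRetraction (r x) (f x) := by
  refine continuous_iff_continuousAt.2 fun x => ?_
  by_cases hx : r x = 0
  · have hzero : ballRetraction (r x) (f x) = 0 := by rw [ballRetraction, hx, zero_smul]
    rw [ContinuousAt, hzero]
    exact squeeze_zero_norm (fun y => norm_ballRetraction_le (hr₀ y) (f y)) (hx ▸ hr.tendsto x)
  · exact hr.continuousAt.smul (continuous_unitBallRetraction.continuousAt.comp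
      ((hr.continuousAt.inv₀ hx).smul hf.continuousAt))

end Retraction

section Hom

variable {B D : Type*}
  [NonUnitalCStarAlgebra B] [PartialOrder B] [StarOrderedRing B]
  [NonUnitalCStarAlgebra D] [PartialOrder D] [StarOrderedRing D]

theorem map_cfcAbs (π : B →⋆ₙₐ[ℂ] D) (b : B) : π (CFC.abs b) = CFC.abs (π b) := by
  refine (CFC.sqrt_unique ?_ (map_nonneg π (CFC.abs_nonneg b))).symm
  rw [← map_mul, CFC.abs_mul_abs, map_mul, map_star]

theorem map_unitBallRetraction (π : B →⋆ₙₐ[ℂ] D) (b : B) :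
    π (unitBallRetraction b) = unitBallRetraction (π b) := by
  have h : π (cfcₙ excessRatio (CFC.abs b)) = cfcₙ excessRatio (π (CFC.abs b)) :=
    π.map_cfcₙ (R := ℝ) excessRatio _ continuous_excessRatio.continuousOn
      (excessRatio_of_le_one zero_le_one) (map_continuous π) (CFC.abs_nonneg b).isSelfAdjoint
      (map_nonneg π (CFC.abs_nonneg b)).isSelfAdjoint
  rw [unitBallRetraction, unitBallRetraction, map_sub, map_mul, h, map_cfcAbs]

theorem map_ballRetraction (π : B →⋆ₙₐ[ℂ] D) (r : ℝ) (b : B) :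
    π (ballRetraction r b) = ballRetraction r (π b) := by
  have hsmul (b : B) (r : ℝ) : π (r • b) = r • π b := map_real_smul π (map_continuous π) r b
  rw [ballRetraction, hsmul, map_unitBallRetraction, hsmul, ballRetraction]

end Hom

/-! ### Contractive, star-preserving and positive maps on a set -/

section Properties

variable {B D : Type*} {f g : D → B} {E F : Set D}

/-- Contractivity on `E` of a map that need not be linear: norms do not increase. -/
def ContractiveOn [Norm D] [Norm B] (f : D → B) (E : Set D) : Prop :=
  ∀ x ∈ E, ‖f x‖ ≤ ‖x‖

/-- Compatibility of `f` with the involution, tested only at those `x ∈ E` for which `star x ∈ E`;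
the theorem calls such maps selfadjoint. -/
def StarPreservingOn [Star D] [Star B] (f : D → B) (E : Set D) : Prop :=
  ∀ x ∈ E, star x ∈ E → f (star x) = star (f x)

/-- Positivity on `E`: nonnegative elements of `E` have nonnegative values. -/
def PositiveOn [Zero D] [LE D] [Zero B] [LE B] (f : D → B) (E : Set D) : Prop :=
  ∀ x ∈ E, 0 ≤ x → 0 ≤ f x

theorem ContractiveOn.congr [Norm D] [Norm B] (hf : ContractiveOn f E) (hgf : EqOn g f E) :
    ContractiveOn g E :=
  fun x hx => (hgf hx).symm ▸ hf x hx

theorem ContractiveOn.union [Norm D] [Norm B] (hE : ContractiveOn f E)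
    (hF : ContractiveOn f F) : ContractiveOn f (E ∪ F) :=
  fun x hx => hx.elim (hE x) (hF x)

theorem StarPreservingOn.congr [Star D] [Star B] (hf : StarPreservingOn f E)
    (hgf : EqOn g f E) : StarPreservingOn g E :=
  fun x hx hx' => by rw [hgf hx, hgf hx', hf x hx hx']

theorem StarPreservingOn.union [InvolutiveStar D] [Star B] (hE : StarPreservingOn f E)
    (hF : StarPreservingOn f F) (hFstar : ∀ x ∈ F, star x ∈ F) :
    StarPreservingOn f (E ∪ F) := by
  rintro x (hx | hx) (hx' | hx')
  · exact hE x hx hx'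
  · exact hF x (star_star x ▸ hFstar _ hx') hx'
  · exact hF x hx (hFstar x hx)
  · exact hF x hx hx'

theorem PositiveOn.congr [Zero D] [LE D] [Zero B] [LE B] (hf : PositiveOn f E)
    (hgf : EqOn g f E) : PositiveOn g E :=
  fun x hx hx₀ => (hgf hx).symm ▸ hf x hx hx₀

theorem PositiveOn.union [Zero D] [LE D] [Zero B] [LE B] (hE : PositiveOn f E)
    (hF : PositiveOn f F) : PositiveOn f (E ∪ F) :=
  fun x hx => hx.elim (hE x) (hF x)

/-- `s` agrees with `f` on `E`, and has on `F` those of the three properties that `f` has on `E`. It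
expresses that extending `f` from `E` to `F` loses none of them. -/
structure IsInheritingExtension [Norm D] [Star D] [Zero D] [LE D] [Norm B] [Star B] [Zero B] [LE B]
    (s f : D → B) (E F : Set D) : Prop where
  eqOn : EqOn s f E
  contractiveOn : ContractiveOn f E → ContractiveOn s F
  starPreservingOn : StarPreservingOn f E → StarPreservingOn s F
  positiveOn : PositiveOn f E → PositiveOn s F

theorem IsInheritingExtension.trans [Norm D] [Star D] [Zero D] [LE D] [Norm B] [Star B] [Zero B]
    [LE B] {s : D → B} {G : Set D} (hsg : IsInheritingExtension s g F G)
    (hgf : IsInheritingExtension g f E F) (hEF : E ⊆ F) : IsInheritingExtension s f E G where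
  eqOn := (hsg.eqOn.mono hEF).trans hgf.eqOn
  contractiveOn h := hsg.contractiveOn (hgf.contractiveOn h)
  starPreservingOn h := hsg.starPreservingOn (hgf.starPreservingOn h)
  positiveOn h := hsg.positiveOn (hgf.positiveOn h)

end Properties

/-! ### Symmetrization with respect to the involution -/

section Symmetrization

open scoped CStarAlgebra

/-- The conjugate `x ↦ f(x⋆)⋆` of `f`; the star-preserving maps are those equal to their
conjugate. -/
def starConj {B D : Type*} [Star B] [Star D] (f : D → B) (x : D) : B := star (f (star x))

/-- The average of `f` and its conjugate, which makes `f` star-preserving. -/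
noncomputable def starSymmetrization {B D : Type*} [AddCommGroup B] [Module ℝ B] [Star B] [Star D]
    (f : D → B) (x : D) : B :=
  midpoint ℝ (f x) (starConj f x)

section Conjugate

variable {B D : Type*} {f g : D → B} {E : Set D}

theorem StarPreservingOn.eqOn_starConj [Star D] [InvolutiveStar B] (hf : StarPreservingOn f E) :
    EqOn f (starConj f) (E ∩ star ⁻¹' E) :=
  fun x hx => by rw [starConj, hf x hx.1 hx.2, star_star]

theorem eqOn_starConj_of_eqOn_preimage_star [InvolutiveStar D] [InvolutiveStar B]
    (h : EqOn g (starConj f) (star ⁻¹' E)) : EqOn (starConj g) f E := fun x hx => by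
  have hx' : star x ∈ star ⁻¹' E := by rwa [mem_preimage, star_star]
  rw [starConj, h hx', starConj, star_star, star_star]

theorem ContractiveOn.starConj [NormedAddCommGroup D] [StarAddMonoid D] [NormedStarGroup D]
    [NormedAddCommGroup B] [StarAddMonoid B] [NormedStarGroup B] (hf : ContractiveOn f E) :
    ContractiveOn (starConj f) (star ⁻¹' E) := fun x hx =>
  (norm_star _).trans_le ((hf (star x) hx).trans_eq (norm_star x))

theorem PositiveOn.starConj [NonUnitalSemiring D] [PartialOrder D] [StarRing D]
    [StarOrderedRing D] [NonUnitalSemiring B] [PartialOrder B] [StarRing B] [StarOrderedRing B]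
    (hf : PositiveOn f E) : PositiveOn (starConj f) (star ⁻¹' E) :=
  fun x hx hx₀ => star_nonneg_iff.2 (hf (star x) hx (star_nonneg_iff.2 hx₀))

theorem starPreservingOn_starSymmetrization [InvolutiveStar D] [AddCommGroup B] [StarAddMonoid B]
    [Module ℝ B] [StarModule ℝ B] (f : D → B) (E : Set D) :
    StarPreservingOn (starSymmetrization f) E := fun x _ _ => by
  simp only [starSymmetrization, starConj, midpoint_eq_smul_add, star_smul, star_add, star_star,
    star_trivial, add_comm]

end Conjugate

variable {B D : Type*} [NonUnitalCStarAlgebra B] [NonUnitalCStarAlgebra D] {f : D → B} {E : Set D}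

theorem IsContinuousSectionOn.starConj {π : B →⋆ₙₐ[ℂ] D} (hf : IsContinuousSectionOn π f E) :
    IsContinuousSectionOn π (starConj f) (star ⁻¹' E) where
  continuousOn := continuous_star.comp_continuousOn
    (hf.continuousOn.comp continuous_star.continuousOn fun _ hx => hx)
  rightInvOn x hx := calc π (star (f (star x)))
    _ = star (star x) := by rw [map_star, hf.rightInvOn hx]
    _ = x := star_star x

theorem IsContinuousSectionOn.starSymmetrization {π : B →⋆ₙₐ[ℂ] D}
    (hf : IsContinuousSectionOn π f univ) :
    IsContinuousSectionOn π (starSymmetrization f) univ where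
  continuousOn := ((hf.continuousOn.add hf.starConj.continuousOn).const_smul (⅟2 : ℝ)).congr
    fun x _ => midpoint_eq_smul_add ℝ (f x) (star (f (star x)))
  rightInvOn x hx := by
    let T : B →L[ℝ] D := (π : B →+ D).toRealLinearMap (map_continuous π)
    have hconj : π (star (f (star x))) = x := hf.starConj.rightInvOn hx
    calc π (midpoint ℝ (f x) (star (f (star x))))
      _ = midpoint ℝ (π (f x)) (π (star (f (star x)))) :=
        T.toLinearMap.toAffineMap.map_midpoint _ _
      _ = x := by rw [hf.rightInvOn hx, hconj, midpoint_self]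

theorem ContractiveOn.starSymmetrization (hf : ContractiveOn f univ) :
    ContractiveOn (starSymmetrization f) univ := fun x hx =>
  mem_closedBall_zero_iff.1 <| (convex_closedBall (0 : B) ‖x‖).midpoint_mem
    (mem_closedBall_zero_iff.2 (hf x hx)) (mem_closedBall_zero_iff.2 (hf.starConj x hx))

theorem PositiveOn.starSymmetrization [PartialOrder B] [StarOrderedRing B] [PartialOrder D]
    [StarOrderedRing D] (hf : PositiveOn f univ) : PositiveOn (starSymmetrization f) univ :=
  fun x hx hx₀ => (convex_Ici (0 : B)).midpoint_mem (hf x hx hx₀) (hf.starConj x hx hx₀)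

end Symmetrization

/-! ### Extension of sections of star homomorphisms -/

section Extension

open scoped CStarAlgebra

theorem exists_continuousSection_eqOn_of_starAlgHom {B D : Type*} [NonUnitalCStarAlgebra B]
    [NonUnitalCStarAlgebra D] {π : B →⋆ₙₐ[ℂ] D} (hπ : Function.Surjective π) {E : Set D}
    (hE : IsClosed E) {f : D → B} (hf : IsContinuousSectionOn π f E) :
    ∃ s, IsContinuousSectionOn π s univ ∧ EqOn s f E :=
  exists_continuousSection_eqOn ((π : B →+ D).toRealLinearMap (map_continuous π)) hπ hE hf

variable {B D : Type*}
  [NonUnitalCStarAlgebra B] [PartialOrder B] [StarOrderedRing B]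
  [NonUnitalCStarAlgebra D] [PartialOrder D] [StarOrderedRing D]
  {π : B →⋆ₙₐ[ℂ] D} {f : D → B} {E : Set D}

theorem IsContinuousSectionOn.cfcAbs (hf : IsContinuousSectionOn π f E) (hE : ∀ x ∈ E, 0 ≤ x) :
    IsContinuousSectionOn π (fun x => CFC.abs (f x)) E where
  continuousOn := CFC.continuous_abs.comp_continuousOn hf.continuousOn
  rightInvOn x hx := by rw [map_cfcAbs, hf.rightInvOn hx, CFC.abs_of_nonneg x (hE x hx)]

theorem exists_positive_continuousSection_eqOn (hπ : Function.Surjective π) (hE : IsClosed E)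
    (hf : IsContinuousSectionOn π f E) (hf₀ : PositiveOn f E) :
    ∃ s, IsContinuousSectionOn π s univ ∧ EqOn s f E ∧ PositiveOn s univ := by
  obtain ⟨σ, hσ, hσf⟩ := exists_continuousSection_eqOn_of_starAlgHom hπ hE hf
  have habs : IsContinuousSectionOn π (fun x => CFC.abs (σ x)) {x : D | 0 ≤ x} :=
    (hσ.mono (subset_univ _)).cfcAbs fun _ hx => hx
  have hagree : EqOn f (fun x => CFC.abs (σ x)) (E ∩ {x | 0 ≤ x}) := fun x ⟨hxE, hx₀⟩ => by
    simp only [hσf hxE, CFC.abs_of_nonneg _ (hf₀ x hxE hx₀)]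
  have hcone : IsClosed {x : D | 0 ≤ x} := CStarAlgebra.isClosed_nonneg
  obtain ⟨g, hg, hgf, hgabs⟩ := hf.exists_glue hE hcone habs hagree
  obtain ⟨s, hs, hsg⟩ := exists_continuousSection_eqOn_of_starAlgHom hπ (hE.union hcone) hg
  refine ⟨s, hs, (hsg.mono subset_union_left).trans hgf, fun x _ hx => ?_⟩
  rw [hsg (.inr hx), hgabs hx]
  exact CFC.abs_nonneg _

/-- The map `f` with each value `f x` retracted to the ball of radius `‖x‖`; it is contractive, and
still a section of `π` if `f` is one. -/
noncomputable def normTruncation (f : D → B) (x : D) : B := ballRetraction ‖x‖ (f x)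

theorem IsContinuousSectionOn.normTruncation (hf : IsContinuousSectionOn π f univ) :
    IsContinuousSectionOn π (normTruncation f) univ where
  continuousOn := (continuous_ballRetraction_comp continuous_norm norm_nonneg
    (continuousOn_univ.1 hf.continuousOn)).continuousOn
  rightInvOn x hx := calc π (ballRetraction ‖x‖ (f x))
    _ = ballRetraction ‖x‖ x := by rw [map_ballRetraction, hf.rightInvOn hx]
    _ = x := ballRetraction_of_norm_le le_rfl

theorem exists_continuousSection_eqOn_contractive_positive (hπ : Function.Surjective π)
    (hE : IsClosed E) (hf : IsContinuousSectionOn π f E) :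
    ∃ s, IsContinuousSectionOn π s univ ∧ EqOn s f E ∧
      (ContractiveOn f E → ContractiveOn s univ) ∧ (PositiveOn f E → PositiveOn s univ) := by
  obtain ⟨σ, hσ, hσf, hσ₀⟩ : ∃ σ, IsContinuousSectionOn π σ univ ∧ EqOn σ f E ∧
      (PositiveOn f E → PositiveOn σ univ) := by
    by_cases hf₀ : PositiveOn f E
    · obtain ⟨σ, hσ, hσf, hσ₀⟩ := exists_positive_continuousSection_eqOn hπ hE hf hf₀
      exact ⟨σ, hσ, hσf, fun _ => hσ₀⟩
    · obtain ⟨σ, hσ, hσf⟩ := exists_continuousSection_eqOn_of_starAlgHom hπ hE hf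
      exact ⟨σ, hσ, hσf, fun h => absurd h hf₀⟩
  by_cases hf₁ : ContractiveOn f E
  · have htrunc : EqOn (normTruncation σ) f E := fun x hx => by
      rw [normTruncation, hσf hx, ballRetraction_of_norm_le (hf₁ x hx)]
    exact ⟨normTruncation σ, hσ.normTruncation, htrunc,
      fun _ x _ => norm_ballRetraction_le (norm_nonneg x) _,
      fun h x hx hx₀ => ballRetraction_nonneg (norm_nonneg x) (hσ₀ h x hx hx₀)⟩
  · exact ⟨σ, hσ, hσf, fun h => absurd h hf₁, hσ₀⟩

theorem exists_inheriting_continuousSection (hπ : Function.Surjective π) (hE : IsClosed E)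
    (hf : IsContinuousSectionOn π f E) :
    ∃ s, IsContinuousSectionOn π s univ ∧ IsInheritingExtension s f E univ := by
  by_cases hstar : StarPreservingOn f E
  · have hE' : IsClosed (star ⁻¹' E) := hE.preimage continuous_star
    obtain ⟨g, hg, hgf, hgconj⟩ := hf.exists_glue hE hE' hf.starConj hstar.eqOn_starConj
    obtain ⟨σ, hσ, hσg, hσ₁, hσ₀⟩ :=
      exists_continuousSection_eqOn_contractive_positive hπ (hE.union hE') hg
    have hσf : EqOn σ f E := (hσg.mono subset_union_left).trans hgf
    have hconj : EqOn (starConj σ) f E :=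
      eqOn_starConj_of_eqOn_preimage_star ((hσg.mono subset_union_right).trans hgconj)
    exact ⟨starSymmetrization σ, hσ.starSymmetrization,
      { eqOn := fun x hx => by rw [starSymmetrization, hσf hx, hconj hx, midpoint_self]
        contractiveOn := fun h =>
          (hσ₁ ((h.congr hgf).union (h.starConj.congr hgconj))).starSymmetrization
        starPreservingOn := fun _ => starPreservingOn_starSymmetrization σ univ
        positiveOn := fun h =>
          (hσ₀ ((h.congr hgf).union (h.starConj.congr hgconj))).starSymmetrization }⟩
  · obtain ⟨s, hs, hsf, hs₁, hs₀⟩ :=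
      exists_continuousSection_eqOn_contractive_positive hπ hE hf
    exact ⟨s, hs, hsf, hs₁, fun h => absurd h hstar, hs₀⟩

end Extension

section Unital

variable {B D : Type*}
  [CStarAlgebra B] [PartialOrder B] [StarOrderedRing B] [CStarAlgebra D] [PartialOrder D]
  {π : B →⋆ₙₐ[ℂ] D} {f : D → B} {E : Set D}

theorem exists_inheritingExtension_insert_one [Nontrivial D] (hπ : Function.Surjective π)
    (hE : IsClosed E) (h1E : 1 ∉ E) (hf : IsContinuousSectionOn π f E) :
    ∃ g, IsContinuousSectionOn π g (E ∪ {1}) ∧ IsInheritingExtension g f E (E ∪ {1}) ∧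
      g 1 = 1 := by
  have : Nontrivial B := hπ.nontrivial
  have hπ1 : π 1 = 1 := by
    obtain ⟨b, hb⟩ := hπ 1
    rw [← mul_one (π 1), ← hb, ← map_mul, one_mul]
  have hone : IsContinuousSectionOn π (1 : D → B) {1} :=
    ⟨continuousOn_const, fun x hx => by rw [mem_singleton_iff.1 hx, Pi.one_apply, hπ1]⟩
  have hone_contractive : ContractiveOn (1 : D → B) {1} := by
    rintro _ rfl
    rw [Pi.one_apply, CStarRing.norm_one, CStarRing.norm_one]
  have hone_star : StarPreservingOn (1 : D → B) {1} := fun _ _ _ => (star_one B).symm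
  have hone_positive : PositiveOn (1 : D → B) {1} := fun _ _ _ => zero_le_one
  have hstar_mem : ∀ x ∈ ({1} : Set D), star x ∈ ({1} : Set D) := by
    rintro _ rfl
    exact star_one D
  obtain ⟨g, hg, hgf, hg1⟩ := hf.exists_glue hE isClosed_singleton hone
    fun x hx => absurd (hx.2 ▸ hx.1) h1E
  exact ⟨g, hg,
    { eqOn := hgf
      contractiveOn := fun h => (h.congr hgf).union (hone_contractive.congr hg1)
      starPreservingOn := fun h => (h.congr hgf).union (hone_star.congr hg1) hstar_mem
      positiveOn := fun h => (h.congr hgf).union (hone_positive.congr hg1) }, hg1 rfl⟩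

variable [StarOrderedRing D]

theorem exists_inheriting_continuousSection_map_one (hπ : Function.Surjective π) (hE : IsClosed E)
    (hED : E.Nonempty ∨ Nontrivial D) (hf : IsContinuousSectionOn π f E) :
    ∃ s, IsContinuousSectionOn π s univ ∧ IsInheritingExtension s f E univ ∧
      ((1 ∈ E → f 1 = 1) → s 1 = 1) := by
  by_cases h1E : (1 : D) ∈ E
  · obtain ⟨s, hs, hsf⟩ := exists_inheriting_continuousSection hπ hE hf
    exact ⟨s, hs, hsf, fun hf1 => (hsf.eqOn h1E).trans (hf1 h1E)⟩
  · have : Nontrivial D := hED.elim (fun ⟨x, hx⟩ => ⟨x, 1, ne_of_mem_of_not_mem hx h1E⟩) id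
    obtain ⟨g, hg, hgf, hg1⟩ := exists_inheritingExtension_insert_one hπ hE h1E hf
    obtain ⟨s, hs, hsg⟩ :=
      exists_inheriting_continuousSection hπ (hE.union isClosed_singleton) hg
    exact ⟨s, hs, hsg.trans hgf subset_union_left, fun _ => (hsg.eqOn (.inr rfl)).trans hg1⟩

end Unital

/-- Part 1: arbitrary (not necessarily unital) C⋆-algebras. Part 2: unital C⋆-algebras, with unitality
of the section as an additional property. In both parts one and the same extension `s` inherits every
property in the list that `s₀` has, so the claim covers every combination of the properties.
For `s₀`, which is defined on `E` only, each property is required where it makes sense. -/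
theorem theorem3p5 :
    (∀ (B D : Type*)
      [NonUnitalCStarAlgebra B] [PartialOrder B] [StarOrderedRing B]
      [NonUnitalCStarAlgebra D] [PartialOrder D] [StarOrderedRing D]
      (π : B →⋆ₙₐ[ℂ] D) (_ : Function.Surjective π)
      (E : Set D) (_ : IsClosed E)
      (s₀ : E → B) (_ : Continuous s₀) (_ : ∀ x : E, π (s₀ x) = x),
      ∃ s : D → B, Continuous s ∧ (∀ x : D, π (s x) = x) ∧ (∀ x : E, s x = s₀ x) ∧
        ((∀ x : E, ‖s₀ x‖ ≤ ‖(x : D)‖) → ∀ x : D, ‖s x‖ ≤ ‖x‖) ∧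
        ((∀ x y : E, (y : D) = star (x : D) → s₀ y = star (s₀ x)) →
          ∀ x : D, s (star x) = star (s x)) ∧
        ((∀ x : E, 0 ≤ (x : D) → 0 ≤ s₀ x) → ∀ x : D, 0 ≤ x → 0 ≤ s x)) ∧
    (∀ (B D : Type*)
      [CStarAlgebra B] [PartialOrder B] [StarOrderedRing B]
      [CStarAlgebra D] [PartialOrder D] [StarOrderedRing D]
      (π : B →⋆ₙₐ[ℂ] D) (_ : Function.Surjective π)
      (E : Set D) (_ : IsClosed E) (_ : E.Nonempty ∨ Nontrivial D)
      (s₀ : E → B) (_ : Continuous s₀) (_ : ∀ x : E, π (s₀ x) = x),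
      ∃ s : D → B, Continuous s ∧ (∀ x : D, π (s x) = x) ∧ (∀ x : E, s x = s₀ x) ∧
        ((∀ x : E, (x : D) = 1 → s₀ x = 1) → s 1 = 1) ∧
        ((∀ x : E, ‖s₀ x‖ ≤ ‖(x : D)‖) → ∀ x : D, ‖s x‖ ≤ ‖x‖) ∧
        ((∀ x y : E, (y : D) = star (x : D) → s₀ y = star (s₀ x)) →
          ∀ x : D, s (star x) = star (s x)) ∧
        ((∀ x : E, 0 ≤ (x : D) → 0 ≤ s₀ x) → ∀ x : D, 0 ≤ x → 0 ≤ s x)) := by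
  refine ⟨fun B D _ _ _ _ _ _ π hπ E hE s₀ hs₀ hπs₀ => ?_,
    fun B D _ _ _ _ _ _ π hπ E hE hED s₀ hs₀ hπs₀ => ?_⟩
  all_goals
    obtain ⟨f, rfl⟩ := Subtype.val_injective.surjective_comp_right s₀
    have hf : IsContinuousSectionOn π f E :=
      ⟨continuousOn_iff_continuous_domRestrict.2 hs₀, fun x hx => hπs₀ ⟨x, hx⟩⟩
  · obtain ⟨s, hs, hsf⟩ := exists_inheriting_continuousSection hπ hE hf
    exact ⟨s, continuousOn_univ.1 hs.continuousOn, fun x => hs.rightInvOn trivial,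
      fun x => hsf.eqOn x.2, fun h x => hsf.contractiveOn (fun x hx => h ⟨x, hx⟩) x trivial,
      fun h x => hsf.starPreservingOn (fun x hx hx' => h ⟨x, hx⟩ ⟨_, hx'⟩ rfl) x trivial trivial,
      fun h x => hsf.positiveOn (fun x hx => h ⟨x, hx⟩) x trivial⟩
  · obtain ⟨s, hs, hsf, hs1⟩ := exists_inheriting_continuousSection_map_one hπ hE hED hf
    exact ⟨s, continuousOn_univ.1 hs.continuousOn, fun x => hs.rightInvOn trivial,
      fun x => hsf.eqOn x.2, fun h => hs1 fun h1 => h ⟨1, h1⟩ rfl,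
      fun h x => hsf.contractiveOn (fun x hx => h ⟨x, hx⟩) x trivial,
      fun h x => hsf.starPreservingOn (fun x hx hx' => h ⟨x, hx⟩ ⟨_, hx'⟩ rfl) x trivial trivial,
      fun h x => hsf.positiveOn (fun x hx => h ⟨x, hx⟩) x trivial⟩
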